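/- Let $d\ge 0$ be an integer and let $\mathbb F_d^+$ be the free monoid on $d$ letters $1,\dots,d$, with empty word $\emptyset$, ordered by the shortlex order $\prec$ (first by length, then lexicographically); for $\sigma\ne\emptyset$ let $\sigma-1$ be the immediate predecessor of $\sigma$. Let $L=(L_1,\dots,L_d)$ be the left free shift on $\mathbb H^2_d=\{\sum_\sigma c_\sigma Z^\sigma:\sum_\sigma|c_\sigma|^2<\infty\}$, $L_kf=Z_kf$; let $\mathcal A_d$ be the norm-closure of $\{P(L): P \text{ an nc polynomial}\}$ and $\mathscr A_d$ the norm-closure of $\mathcal A_d+\mathcal A_d^*$. An nc measure is a linear functional $\mu:\mathscr A_d\to\mathbb C$ with $\mu(f)\ge0$ whenever $f\ge0$; it is a probability nc measure if $\mu(I)=1$, and non-trivial if the matrix $[\mu((L^\tau)^*L^\sigma)]_{\sigma,\tau\preceq\sigma_0}$ is invertible for every $\sigma_0\in\mathbb F_d^+$. Let $\mu$ be a non-trivial probability nc measure and $\langle P,Q\rangle_\mu=\mu(Q(L)^*P(L))$ for nc polynomials $P,Q$. Let $(\Phi_\sigma)$ and $(\varphi_\sigma)$ be the monic orthogonal and the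 orthonormal polynomials obtained from $(Z^\sigma)_{\sigma\in\mathbb F_d^+}$, in shortlex order, by the Gram–Schmidt process for $\langle\cdot,\cdot\rangle_\mu$ without and with normalisation, and let $a_{\sigma,\tau}$ be the coefficient of $Z^\tau$ in $\varphi_\sigma$. Let $\sigma_0\prec\sigma_1\prec\cdots$ be the enumeration of $\mathbb F_d^+$ in shortlex order (so $\sigma_0=\emptyset$), and put $S_{k,j}=\langle Z^{\sigma_j},Z^{\sigma_k}\rangle_\mu$. The Schur parameters of this positive definite kernel are the numbers $\gamma_{k,j}$ ($k\le j$) with $\gamma_{k,k}=0$ that are determined, by recursion on $j-k$ and with $d_{k,j}=\sqrt{1-|\gamma_{k,j}|^2}$, by $$S_{k,j}=L_{k,j-1}U_{k+1,j-1}C_{k+1,j}+\gamma_{k,j}\prod_{k<m<j}d_{k,m}\,d_{m,j}\qquad(k<j).$$ Here $L_{k,j}=(\gamma_{k,k+1},\,d_{k,k+1}\gamma_{k,k+2},\dots,\,d_{k,k+1}\cdots d_{k,j-1}\gamma_{k,j})$ is a row, $C_{k,j}=(\gamma_{j-1,j},\,\gamma_{j-2,j}d_{j-1,j},\dots,\,\gamma_{k,j}d_{k+1,j}\cdots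 d_{j-1,j})^{\mathsf T}$ is a column (the product $L_{k,j-1}U_{k+1,j-1}C_{k+1,j}$ is $0$ if $j=k+1$), and $U_{k,k}=1$, $U_{k,j}=R_0(\gamma_{k,k+1})R_1(\gamma_{k,k+2})\cdots R_{j-k-1}(\gamma_{k,j})\,(U_{k+1,j}\oplus1)$, where $R_p(z)$ acts as $\begin{pmatrix}z&\sqrt{1-|z|^2}\\ \sqrt{1-|z|^2}&-\bar z\end{pmatrix}$ on the coordinates $p,p+1$ (counted from $0$) and as the identity on the others. The Verblunsky coefficients of $\mu$ are $\gamma_{\sigma}:=\gamma_{0,n}$ for $\sigma=\sigma_n$. The reverse polynomials are defined by $\varphi^\#_\emptyset=1$, $$\varphi^\#_{k\sigma}=\frac1{\sqrt{1-|\gamma_{k\sigma}|^2}}\bigl(-\overline{\gamma_{k\sigma}}\,Z_k\varphi_\sigma+\varphi^\#_{k\sigma-1}\bigr)\qquad(k=1,\dots,d,\ \sigma\in\mathbb F_d^+),$$ and $\Phi^\#_\sigma=\frac1{a_{\sigma,\sigma}}\varphi^\#_\sigma$. **Theorem.** One has $a_{\sigma,\sigma}\neq0$ and $|\gamma_\sigma|<1$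 for all $\sigma\in\mathbb F_d^+$, and for all $k\in\{1,\dots,d\}$ and $\sigma\in\mathbb F_d^+$ the nc Szegő recurrences hold: $$\Phi_{k\sigma}=Z_k\Phi_\sigma-\gamma_{k\sigma}\frac{a_{k\sigma-1,k\sigma-1}}{a_{\sigma,\sigma}}\Phi^\#_{k\sigma-1},\qquad \Phi^\#_{k\sigma}=-\overline{\gamma_{k\sigma}}\,Z_k\Phi_\sigma+\frac{a_{k\sigma-1,k\sigma-1}}{a_{\sigma,\sigma}}\Phi^\#_{k\sigma-1}.$$ -/

import Mathlib

open scoped ComplexOrder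

noncomputable section

namespace NCSzego

/-! ### Words, the shortlex order -/

/-- The free monoid on `d` generators, i.e. the words in the letters `0, …, d - 1`. -/
def Word (d : ℕ) : Type := FreeMonoid (Fin d)

namespace Word

variable {d : ℕ}

instance : CancelMonoid (Word d) := inferInstanceAs (CancelMonoid (FreeMonoid (Fin d)))

/-- The list of letters of a word. -/
def toList (σ : Word d) : List (Fin d) := FreeMonoid.toList σ

/-- The word with a given list of letters. -/
def ofList (l : List (Fin d)) : Word d := FreeMonoid.ofList l

/-- The one-letter word `k`; thus the word `kσ` is `letter k * σ`. -/
def letter (k : Fin d) : Word d := FreeMonoid.of k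

theorem toList_injective : Function.Injective (toList : Word d → List (Fin d)) :=
  FreeMonoid.toList.injective

@[simp] theorem toList_one : (1 : Word d).toList = [] := rfl

@[simp] theorem toList_letter_mul (k : Fin d) (σ : Word d) :
    (letter k * σ).toList = k :: σ.toList := rfl

theorem induction {p : Word d → Prop} (one : p 1)
    (letter_mul : ∀ k σ, p σ → p (letter k * σ)) (σ : Word d) : p σ :=
  FreeMonoid.inductionOn' (motive := p) σ one letter_mul

/-- The short lexicographical order: words are compared first by length, and words of the same
length lexicographically. -/
instance : LinearOrder (Word d) :=
  LinearOrder.lift' (fun σ : Word d => toLex (σ.toList.length, σ.toList)) (by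
    intro σ τ h
    have h2 := congrArg (fun p => (ofLex p).2) h
    exact toList_injective h2)

theorem le_iff {σ τ : Word d} : σ ≤ τ ↔
    σ.toList.length < τ.toList.length ∨
      (σ.toList.length = τ.toList.length ∧ σ.toList ≤ τ.toList) :=
  Prod.Lex.toLex_le_toLex

theorem lt_iff {σ τ : Word d} : σ < τ ↔
    σ.toList.length < τ.toList.length ∨
      (σ.toList.length = τ.toList.length ∧ σ.toList < τ.toList) :=
  Prod.Lex.toLex_lt_toLex

theorem finite_Iic (σ : Word d) : (Set.Iic σ).Finite := by
  have h : (toList ⁻¹' {l : List (Fin d) | l.length ≤ σ.toList.length}).Finite :=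
    (List.finite_length_le (Fin d) _).preimage toList_injective.injOn
  refine h.subset fun τ hτ => ?_
  rcases le_iff.1 hτ with h | h
  · exact h.le
  · exact h.1.le

instance : LocallyFiniteOrderBot (Word d) :=
  LocallyFiniteOrderBot.ofIic (Word d) (fun σ => (finite_Iic σ).toFinset) (by simp)

instance : WellFoundedLT (Word d) := by
  refine ⟨Subrelation.wf (r := InvImage (· < ·) fun σ : Word d => (Finset.Iio σ).card) ?_
    (InvImage.wf _ Nat.lt_wfRel.wf)⟩
  intro σ τ h
  refine Finset.card_lt_card (Finset.ssubset_iff_subset_ne.2 ⟨?_, ?_⟩)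
  · intro x hx
    exact Finset.mem_Iio.2 ((Finset.mem_Iio.1 hx).trans h)
  · intro he
    have : σ ∈ Finset.Iio σ := he ▸ Finset.mem_Iio.2 h
    exact lt_irrefl _ (Finset.mem_Iio.1 this)

instance : WellFoundedRelation (Word d) := ⟨(· < ·), wellFounded_lt⟩

theorem one_lt_letter_mul (k : Fin d) (σ : Word d) : 1 < letter k * σ :=
  lt_iff.2 (Or.inl (by simp))

/-- The immediate predecessor `σ - 1` of a word in the shortlex order, i.e. the largest word
that strictly precedes it (the empty word has none, and is sent to itself). -/
def pred (σ : Word d) : Word d :=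
  if h : (Finset.Iio σ).Nonempty then (Finset.Iio σ).max' h else σ

theorem pred_letter_mul_lt (k : Fin d) (σ : Word d) : pred (letter k * σ) < letter k * σ := by
  have h : (Finset.Iio (letter k * σ)).Nonempty := ⟨1, Finset.mem_Iio.2 (one_lt_letter_mul k σ)⟩
  rw [pred, dif_pos h]
  exact Finset.mem_Iio.1 (Finset.max'_mem _ h)

/-- The position of a word in the shortlex order, counted from `0`. -/
def rank (σ : Word d) : ℕ := (Finset.Iio σ).card

/-- The word at position `n` in the shortlex order (a junk value if there is none, which only
happens for `d = 0` and `n ≠ 0`). -/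
def nth (d n : ℕ) : Word d := Function.invFun (rank : Word d → ℕ) n

end Word

/-! ### The nc Hardy space and the left free shift -/

/-- The nc Hardy space in `d` variables: square-summable power series `∑ c_σ Z^σ`, identified
with their coefficients. -/
abbrev Hardy (d : ℕ) : Type := lp (fun _ : Word d => ℂ) 2

variable {d : ℕ}

theorem letter_mul_injective (k : Fin d) :
    Function.Injective (fun σ : Word d => Word.letter k * σ) := fun _ _ h => mul_left_cancel h

/-- Coefficients of `Z_k f`: the coefficient at `kσ` is that of `f` at `σ`, and the coefficient at
a word that does not start with `k` is zero. -/
def shiftCoeff (k : Fin d) (f : Word d → ℂ) : Word d → ℂ :=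
  Function.extend (fun σ => Word.letter k * σ) f 0

theorem norm_shiftCoeff_sq (k : Fin d) (f : Word d → ℂ) :
    (fun σ => ‖shiftCoeff k f σ‖ ^ 2) =
      Function.extend (fun σ : Word d => Word.letter k * σ) (fun σ => ‖f σ‖ ^ 2) 0 := by
  funext σ
  by_cases h : ∃ τ, (fun τ : Word d => Word.letter k * τ) τ = σ
  · obtain ⟨τ, rfl⟩ := h
    simp only [shiftCoeff]
    rw [(letter_mul_injective k).extend_apply, (letter_mul_injective k).extend_apply]
  · simp only [shiftCoeff]
    rw [Function.extend_apply' _ _ _ h, Function.extend_apply' _ _ _ h]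
    simp

theorem hasSum_shiftCoeff (k : Fin d) (f : Hardy d) :
    HasSum (fun σ => ‖shiftCoeff k f σ‖ ^ 2) (‖f‖ ^ 2) := by
  rw [norm_shiftCoeff_sq]
  refine (hasSum_extend_zero (letter_mul_injective k)).2 ?_
  have h := lp.hasSum_norm (p := 2) (by norm_num) f
  simpa using h

theorem memℓp_shiftCoeff (k : Fin d) (f : Hardy d) : Memℓp (shiftCoeff k f) 2 :=
  memℓp_gen (by simpa using (hasSum_shiftCoeff k f).summable)

/-- The `k`-th left shift `L_k f = Z_k f`, an isometry of the nc Hardy space. -/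
def shiftIsometry (k : Fin d) : Hardy d →ₗᵢ[ℂ] Hardy d where
  toFun f := ⟨shiftCoeff k f, memℓp_shiftCoeff k f⟩
  map_add' f g := by
    ext σ
    change shiftCoeff k (f + g) σ = shiftCoeff k f σ + shiftCoeff k g σ
    by_cases h : ∃ τ, (fun τ : Word d => Word.letter k * τ) τ = σ
    · obtain ⟨τ, rfl⟩ := h
      simp only [shiftCoeff]
      rw [(letter_mul_injective k).extend_apply, (letter_mul_injective k).extend_apply,
        (letter_mul_injective k).extend_apply]
      rfl
    · simp only [shiftCoeff]
      rw [Function.extend_apply' _ _ _ h, Function.extend_apply' _ _ _ h,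
        Function.extend_apply' _ _ _ h]
      simp
  map_smul' c f := by
    ext σ
    change shiftCoeff k (c • f) σ = c * shiftCoeff k f σ
    by_cases h : ∃ τ, (fun τ : Word d => Word.letter k * τ) τ = σ
    · obtain ⟨τ, rfl⟩ := h
      simp only [shiftCoeff]
      rw [(letter_mul_injective k).extend_apply, (letter_mul_injective k).extend_apply]
      rfl
    · simp only [shiftCoeff]
      rw [Function.extend_apply' _ _ _ h, Function.extend_apply' _ _ _ h]
      simp
  norm_map' f := by
    have h1 := hasSum_shiftCoeff k f
    have h2 := lp.hasSum_norm (p := 2) (by norm_num)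
      (⟨shiftCoeff k f, memℓp_shiftCoeff k f⟩ : Hardy d)
    have h3 : ‖(⟨shiftCoeff k f, memℓp_shiftCoeff k f⟩ : Hardy d)‖ ^ 2 = ‖f‖ ^ 2 := by
      refine HasSum.unique ?_ h1
      simpa using h2
    exact (sq_eq_sq₀ (norm_nonneg _) (norm_nonneg _)).1 h3

/-- The left free shift `L = (L_1, …, L_d)`. -/
def leftShift (k : Fin d) : Hardy d →L[ℂ] Hardy d := (shiftIsometry k).toContinuousLinearMap

open ContinuousLinearMap in
theorem adjoint_leftShift_mul (j k : Fin d) :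
    adjoint (leftShift j) * leftShift k = if j = k then 1 else 0 := by
  refine ContinuousLinearMap.ext fun f => ext_inner_left ℂ fun g => ?_
  change inner ℂ g (adjoint (leftShift j) (leftShift k f)) = _
  rw [adjoint_inner_right]
  split_ifs with h
  · subst h
    exact (shiftIsometry j).inner_map_map g f
  · change _ = inner ℂ g (0 : Hardy d)
    rw [inner_zero_right, lp.inner_eq_tsum]
    convert tsum_zero with σ
    change inner ℂ (shiftCoeff j g σ) (shiftCoeff k f σ) = 0
    by_cases h1 : ∃ τ, (fun τ : Word d => Word.letter j * τ) τ = σ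
    · have h2 : ¬ ∃ τ, (fun τ : Word d => Word.letter k * τ) τ = σ := by
        rintro ⟨τ', h2⟩
        obtain ⟨τ, h1⟩ := h1
        have h3 := congrArg Word.toList (h1.trans h2.symm)
        simp only [Word.toList_letter_mul, List.cons.injEq] at h3
        exact h h3.1
      rw [shiftCoeff, shiftCoeff, Function.extend_apply' _ _ _ h2]
      simp
    · rw [shiftCoeff, Function.extend_apply' _ _ _ h1]
      simp

/-! ### Noncommutative polynomials and the nc disc system -/

/-- Noncommutative polynomials in `Z_1, …, Z_d`: finite combinations of the monomials `Z^σ`. -/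
abbrev NCPoly (d : ℕ) : Type := MonoidAlgebra ℂ (Word d)

/-- The monomial `Z^σ`. -/
def monomial (σ : Word d) : NCPoly d := MonoidAlgebra.of ℂ (Word d) σ

/-- The indeterminate `Z_k`. -/
def Z (k : Fin d) : NCPoly d := monomial (Word.letter k)

/-- The operator `L^σ = L_{σ_1} ⋯ L_{σ_n}`. -/
def shiftPow : Word d →* (Hardy d →L[ℂ] Hardy d) := FreeMonoid.lift leftShift

/-- The operator `P(L)`, for an nc polynomial `P`. -/
def evalShift : NCPoly d →ₐ[ℂ] (Hardy d →L[ℂ] Hardy d) := MonoidAlgebra.lift ℂ _ (Word d) shiftPow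

/-- The nc disc algebra: the norm-closure of `{P(L) : P an nc polynomial}`. -/
def discAlgebra (d : ℕ) : Set (Hardy d →L[ℂ] Hardy d) :=
  closure (Set.range (evalShift : NCPoly d → (Hardy d →L[ℂ] Hardy d)))

/-- The nc disc system: the norm-closure of the linear span of the nc disc algebra and of the
adjoints of its elements. -/
def discSystem (d : ℕ) : Submodule ℂ (Hardy d →L[ℂ] Hardy d) :=
  (Submodule.span ℂ (discAlgebra d ∪
    {T | ∃ f ∈ discAlgebra d, T = ContinuousLinearMap.adjoint f})).topologicalClosure

theorem shiftPow_mem (σ : Word d) : shiftPow σ ∈ discSystem d := by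
  refine Submodule.le_topologicalClosure _ (Submodule.subset_span (Or.inl (subset_closure ?_)))
  exact ⟨monomial σ, by simp [evalShift, monomial]⟩

theorem adjoint_shiftPow_mem (σ : Word d) :
    ContinuousLinearMap.adjoint (shiftPow σ) ∈ discSystem d := by
  refine Submodule.le_topologicalClosure _ (Submodule.subset_span (Or.inr ⟨shiftPow σ, ?_, rfl⟩))
  exact subset_closure ⟨monomial σ, by simp [evalShift, monomial]⟩

theorem shiftPow_letter_mul (k : Fin d) (σ : Word d) :
    shiftPow (Word.letter k * σ) = leftShift k * shiftPow σ := by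
  rw [map_mul]
  congr 1

theorem adjoint_shiftPow_mul_shiftPow_mem (τ σ : Word d) :
    ContinuousLinearMap.adjoint (shiftPow τ) * shiftPow σ ∈ discSystem d := by
  induction τ using Word.induction generalizing σ with
  | one =>
    rw [map_one, ← ContinuousLinearMap.star_eq_adjoint, star_one, one_mul]
    exact shiftPow_mem σ
  | letter_mul j τ ih =>
    induction σ using Word.induction with
    | one =>
      rw [map_one, mul_one]
      exact adjoint_shiftPow_mem _
    | letter_mul k σ _ =>
      have h : ContinuousLinearMap.adjoint (shiftPow (Word.letter j * τ)) *
          shiftPow (Word.letter k * σ) =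
          ContinuousLinearMap.adjoint (shiftPow τ) *
            (ContinuousLinearMap.adjoint (leftShift j) * leftShift k) * shiftPow σ := by
        rw [shiftPow_letter_mul, shiftPow_letter_mul]
        simp only [← ContinuousLinearMap.star_eq_adjoint, star_mul, mul_assoc]
      rw [h, adjoint_leftShift_mul]
      split_ifs
      · rw [mul_one]
        exact ih σ
      · rw [mul_zero, zero_mul]
        exact Submodule.zero_mem _

theorem adjoint_eval_mul_eval_mem (Q P : NCPoly d) :
    ContinuousLinearMap.adjoint (evalShift Q) * evalShift P ∈ discSystem d := by
  induction Q using MonoidAlgebra.induction_linear with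
  | zero =>
    rw [map_zero, map_zero, zero_mul]
    exact Submodule.zero_mem _
  | add Q₁ Q₂ h₁ h₂ =>
    rw [map_add, map_add, add_mul]
    exact Submodule.add_mem _ h₁ h₂
  | single τ b =>
    induction P using MonoidAlgebra.induction_linear with
    | zero =>
      rw [map_zero, mul_zero]
      exact Submodule.zero_mem _
    | add P₁ P₂ h₁ h₂ =>
      rw [map_add, mul_add]
      exact Submodule.add_mem _ h₁ h₂
    | single σ a =>
      rw [evalShift, MonoidAlgebra.lift_single, MonoidAlgebra.lift_single, map_smulₛₗ,
        smul_mul_smul_comm]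
      exact Submodule.smul_mem _ _ (adjoint_shiftPow_mul_shiftPow_mem τ σ)

theorem one_mem_discSystem : (1 : Hardy d →L[ℂ] Hardy d) ∈ discSystem d := by
  have h := shiftPow_mem (1 : Word d)
  rwa [map_one] at h

/-! ### Nc measures -/

/-- An nc measure: a linear functional on the nc disc system that takes nonnegative values on
positive operators. -/
structure NCMeasure (d : ℕ) where
  toFun : discSystem d →ₗ[ℂ] ℂ
  nonneg : ∀ f : discSystem d, (f : Hardy d →L[ℂ] Hardy d).IsPositive → 0 ≤ toFun f

namespace NCMeasure

variable (μ : NCMeasure d)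

/-- A probability nc measure is one with `μ(I) = 1`. -/
def IsProbability : Prop := μ.toFun ⟨1, one_mem_discSystem⟩ = 1

/-- The form `⟨P, Q⟩_μ = μ(Q(L)* P(L))`, linear in `P`. -/
def form (P Q : NCPoly d) : ℂ :=
  μ.toFun ⟨ContinuousLinearMap.adjoint (evalShift Q) * evalShift P, adjoint_eval_mul_eval_mem Q P⟩

/-- The multi-Toeplitz kernel `K_μ(σ, τ) = μ((L^τ)* L^σ)`. -/
def kernel (σ τ : Word d) : ℂ :=
  μ.toFun ⟨ContinuousLinearMap.adjoint (shiftPow τ) * shiftPow σ,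
    adjoint_shiftPow_mul_shiftPow_mem τ σ⟩

/-- An nc measure is non-trivial if all the matrices `[K_μ(σ, τ)]_{σ, τ ≼ σ₀}` are invertible. -/
def IsNontrivial : Prop :=
  ∀ σ₀ : Word d, IsUnit (Matrix.of fun σ τ : Finset.Iic σ₀ => μ.kernel σ τ)

theorem form_monomial (σ τ : Word d) : μ.form (monomial σ) (monomial τ) = μ.kernel σ τ := by
  simp only [form, kernel]
  congr 2
  simp [evalShift, monomial]

theorem form_add_left (P₁ P₂ Q : NCPoly d) :
    μ.form (P₁ + P₂) Q = μ.form P₁ Q + μ.form P₂ Q := by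
  simp only [form, ← map_add]
  congr 1
  apply Subtype.ext
  simp [mul_add]

theorem form_add_right (P Q₁ Q₂ : NCPoly d) :
    μ.form P (Q₁ + Q₂) = μ.form P Q₁ + μ.form P Q₂ := by
  simp only [form, ← map_add]
  congr 1
  apply Subtype.ext
  simp [add_mul]

theorem form_smul_left (c : ℂ) (P Q : NCPoly d) : μ.form (c • P) Q = c * μ.form P Q := by
  simp only [form, ← smul_eq_mul, ← map_smul]
  congr 1
  apply Subtype.ext
  simp

theorem form_smul_right (c : ℂ) (P Q : NCPoly d) :
    μ.form P (c • Q) = (starRingEnd ℂ) c * μ.form P Q := by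
  simp only [form, ← smul_eq_mul, ← map_smul]
  congr 1
  apply Subtype.ext
  change ContinuousLinearMap.adjoint (evalShift (c • Q)) * evalShift P =
    (starRingEnd ℂ) c • (ContinuousLinearMap.adjoint (evalShift Q) * evalShift P)
  rw [map_smul, map_smulₛₗ, smul_mul_assoc]

theorem form_self_nonneg (P : NCPoly d) : 0 ≤ μ.form P P :=
  μ.nonneg _ (ContinuousLinearMap.isPositive_adjoint_comp_self (evalShift P))

theorem form_conj_symm (P Q : NCPoly d) : (starRingEnd ℂ) (μ.form P Q) = μ.form Q P := by
  have h0 := (Complex.le_def.1 (μ.form_self_nonneg P)).2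
  have h1 := (Complex.le_def.1 (μ.form_self_nonneg Q)).2
  have h2 := (Complex.le_def.1 (μ.form_self_nonneg (P + Q))).2
  have h3 := (Complex.le_def.1 (μ.form_self_nonneg (P + Complex.I • Q))).2
  simp only [form_add_left, form_add_right, form_smul_left, form_smul_right, Complex.add_im,
    Complex.zero_im, Complex.mul_im, Complex.mul_re, Complex.I_re, Complex.I_im,
    Complex.conj_I, Complex.neg_re, Complex.neg_im,
    Complex.add_re] at h0 h1 h2 h3
  apply Complex.ext
  · rw [Complex.conj_re]
    linarith
  · rw [Complex.conj_im]
    linarith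

/-- The positive semidefinite inner product `inner P Q = ⟨Q, P⟩_μ` on nc polynomials
(Mathlib's inner products are linear in the second variable). -/
@[reducible] def preCore : PreInnerProductSpace.Core ℂ (NCPoly d) where
  inner P Q := μ.form Q P
  conj_inner_symm P Q := μ.form_conj_symm P Q
  re_inner_nonneg P := (Complex.le_def.1 (μ.form_self_nonneg P)).1
  add_left P Q R := μ.form_add_right R P Q
  smul_left P Q r := μ.form_smul_right r Q P

theorem form_eq_zero_of_self {P : NCPoly d} (h : μ.form P P = 0) (Q : NCPoly d) :
    μ.form P Q = 0 := by
  let _ := μ.preCore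
  have h1 := InnerProductSpace.Core.inner_mul_inner_self_le (𝕜 := ℂ) Q P
  change ‖μ.form P Q‖ * ‖μ.form Q P‖ ≤ (μ.form Q Q).re * (μ.form P P).re at h1
  rw [h, ← μ.form_conj_symm P Q, RCLike.norm_conj, Complex.zero_re, mul_zero] at h1
  have h2 : ‖μ.form P Q‖ = 0 := by nlinarith [norm_nonneg (μ.form P Q)]
  exact norm_eq_zero.1 h2

theorem form_eq_sum (P : NCPoly d) (τ : Word d) (s : Finset (Word d)) (hs : P.coeff.support ⊆ s) :
    μ.form P (monomial τ) = ∑ σ ∈ s, P.coeff σ * μ.kernel σ τ := by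
  have h : ∀ P : NCPoly d,
      μ.form P (monomial τ) = P.coeff.sum fun σ a => a * μ.kernel σ τ := by
    intro P
    induction P using MonoidAlgebra.induction_linear with
    | zero =>
      have := μ.form_smul_left 0 (0 : NCPoly d) (monomial τ)
      rw [zero_smul, zero_mul] at this
      simp [this]
    | add P₁ P₂ h₁ h₂ =>
      rw [form_add_left, h₁, h₂, MonoidAlgebra.coeff_add,
        Finsupp.sum_add_index' (by simp) (by intros; ring)]
    | single σ a =>
      have h : (MonoidAlgebra.single σ a : NCPoly d) = a • monomial σ := by
        simp [monomial]
      rw [h, form_smul_left, form_monomial, ← h, MonoidAlgebra.coeff_single,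
        Finsupp.sum_single_index (by simp)]
  rw [h P, Finsupp.sum_of_support_subset _ hs _ (by simp)]

variable {μ}

theorem IsNontrivial.definite (hμ : μ.IsNontrivial) (P : NCPoly d) (h : μ.form P P = 0) :
    P = 0 := by
  obtain ⟨σ₀, hσ₀⟩ : ∃ σ₀ : Word d, P.coeff.support ⊆ Finset.Iic σ₀ := by
    refine ⟨(insert 1 P.coeff.support).sup' ⟨1, by simp⟩ id, fun σ hσ => ?_⟩
    exact Finset.mem_Iic.2 (Finset.le_sup' id (Finset.mem_insert_of_mem hσ))
  have h1 : Matrix.vecMul (fun σ : Finset.Iic σ₀ => P.coeff σ)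
      (Matrix.of fun σ τ : Finset.Iic σ₀ => μ.kernel σ τ) = 0 := by
    funext τ
    have h2 := μ.form_eq_sum P τ _ hσ₀
    rw [form_eq_zero_of_self μ h] at h2
    rw [← Finset.sum_coe_sort] at h2
    exact h2.symm
  have h3 := Matrix.vecMul_injective_of_isUnit (hμ σ₀)
  have h4 : (fun σ : Finset.Iic σ₀ => P.coeff σ) = 0 := h3 (h1.trans (Matrix.zero_vecMul _).symm)
  apply MonoidAlgebra.coeff_injective
  ext σ
  by_cases hσ : σ ∈ P.coeff.support
  · exact congrFun h4 ⟨σ, hσ₀ hσ⟩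
  · simpa using hσ

variable (μ)

/-- The inner product `inner P Q = ⟨Q, P⟩_μ` on nc polynomials, positive definite for a
non-trivial nc measure. Its completion is `L²(μ)`. -/
@[reducible] def core (hμ : μ.IsNontrivial) : InnerProductSpace.Core ℂ (NCPoly d) :=
  { μ.preCore with definite := fun P h => hμ.definite P h }

/-! ### Orthogonal polynomials -/

/-- The monic orthogonal polynomials `Φ_σ`: the Gram-Schmidt process, without normalisation,
applied to the monomials `Z^σ` in the shortlex order. -/
def monicPoly (hμ : μ.IsNontrivial) (σ : Word d) : NCPoly d :=
  letI : NormedAddCommGroup (NCPoly d) := (μ.core hμ).toNormedAddCommGroup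
  letI : InnerProductSpace ℂ (NCPoly d) := InnerProductSpace.ofCore (μ.core hμ).toCore
  InnerProductSpace.gramSchmidt ℂ (monomial : Word d → NCPoly d) σ

/-- The orthonormal polynomials `φ_σ`: the Gram-Schmidt process, with normalisation. -/
def orthoPoly (hμ : μ.IsNontrivial) (σ : Word d) : NCPoly d :=
  letI : NormedAddCommGroup (NCPoly d) := (μ.core hμ).toNormedAddCommGroup
  letI : InnerProductSpace ℂ (NCPoly d) := InnerProductSpace.ofCore (μ.core hμ).toCore
  InnerProductSpace.gramSchmidtNormed ℂ (monomial : Word d → NCPoly d) σ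

/-- The coefficient `a_{σ,τ}` of `Z^τ` in `φ_σ`. -/
def a (hμ : μ.IsNontrivial) (σ τ : Word d) : ℂ := (μ.orthoPoly hμ σ).coeff τ

end NCMeasure

/-! ### Schur parameters of a kernel on `ℕ` -/

/-- The defect `√(1 - |z|²)`. -/
def defect (z : ℂ) : ℝ := Real.sqrt (1 - ‖z‖ ^ 2)

/-- The row `L_{k,j} = (γ_{k,k+1}, d_{k,k+1} γ_{k,k+2}, …, d_{k,k+1} ⋯ d_{k,j-1} γ_{k,j})`, as a
sequence whose `p`-th entry (`p = 0, 1, …`) is that involving `γ_{k,k+1+p}`. -/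
def schurRow (γ : ℕ → ℕ → ℂ) (k p : ℕ) : ℂ :=
  (∏ m ∈ Finset.Ioo k (k + 1 + p), (defect (γ k m) : ℂ)) * γ k (k + 1 + p)

/-- The column `C_{k,j} = (γ_{j-1,j}, γ_{j-2,j} d_{j-1,j}, …, γ_{k,j} d_{k+1,j} ⋯ d_{j-1,j})ᵀ`, as a
sequence whose `p`-th entry (`p = 0, 1, …, j - k - 1`) is that involving `γ_{j-1-p,j}`. -/
def schurColumn (γ : ℕ → ℕ → ℂ) (j p : ℕ) : ℂ :=
  γ (j - 1 - p) j * ∏ m ∈ Finset.Ioo (j - 1 - p) j, (defect (γ m j) : ℂ)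

/-- The elementary rotation with matrix `[z, d; d, -conj z]`, `d = √(1 - |z|²)`, acting on the
entries `p` and `p + 1` of a sequence. -/
def rotation (p : ℕ) (z : ℂ) (x : ℕ → ℂ) : ℕ → ℂ := fun i =>
  if i = p then z * x p + defect z * x (p + 1)
  else if i = p + 1 then defect z * x p - (starRingEnd ℂ) z * x (p + 1)
  else x i

/-- The product `R_0(γ_{k,k+1}) R_1(γ_{k,k+2}) ⋯ R_{n-1}(γ_{k,k+n})` of elementary rotations. -/
def rotations (γ : ℕ → ℕ → ℂ) (k : ℕ) : ℕ → (ℕ → ℂ) → ℕ → ℂ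
  | 0, x => x
  | n + 1, x => rotations γ k n (rotation n (γ k (k + 1 + n)) x)

/-- The generalised rotation `U_{k,k+n}`, a unitary on the first `n + 1` entries of a sequence:
`U_{k,k} = 1` and `U_{k,j} = R_0(γ_{k,k+1}) ⋯ R_{j-k-1}(γ_{k,j}) (U_{k+1,j} ⊕ 1)`. -/
def generalRotation (γ : ℕ → ℕ → ℂ) : ℕ → ℕ → (ℕ → ℂ) → ℕ → ℂ
  | _, 0, x => x
  | k, n + 1, x => rotations γ k (n + 1) (generalRotation γ (k + 1) n x)

/-- The number `L_{k,j-1} U_{k+1,j-1} C_{k+1,j}` (zero if `j = k + 1`). -/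
def schurCentre (γ : ℕ → ℕ → ℂ) (k j : ℕ) : ℂ :=
  ∑ p ∈ Finset.range (j - k - 1),
    schurRow γ k p * generalRotation γ (k + 1) (j - k - 2) (schurColumn γ j) p

/-- The number `d_{k,k+1} ⋯ d_{k,j-1} d_{k+1,j} ⋯ d_{j-1,j}`. -/
def schurRadius (γ : ℕ → ℕ → ℂ) (k j : ℕ) : ℝ :=
  (∏ m ∈ Finset.Ioo k j, defect (γ k m)) * ∏ m ∈ Finset.Ioo k j, defect (γ m j)

/-- The table of the Schur parameters `γ_{k,j}` with `k ≤ j ≤ k + n` (and zero elsewhere). -/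
def schurTable (S : ℕ → ℕ → ℂ) : ℕ → ℕ → ℕ → ℂ
  | 0 => fun _ _ => 0
  | n + 1 => fun k j =>
    if j = k + (n + 1) then
      (S k j - schurCentre (schurTable S n) k j) / schurRadius (schurTable S n) k j
    else schurTable S n k j

/-- The Schur parameters `γ_{k,j}`, `k ≤ j`, of a positive definite kernel `S` on `ℕ` with
`S k k = 1`: one has `γ_{k,k} = 0` and, for `k < j`,
`S k j = L_{k,j-1} U_{k+1,j-1} C_{k+1,j}
  + d_{k,k+1} ⋯ d_{k,j-1} γ_{k,j} d_{k+1,j} ⋯ d_{j-1,j}`,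
which determines them recursively on `j - k`. -/
def schurParameter (S : ℕ → ℕ → ℂ) (k j : ℕ) : ℂ := schurTable S (j - k) k j

namespace NCMeasure

variable (μ : NCMeasure d)

/-- The kernel of the moments of `μ` on `ℕ`, carried over along the shortlex order. With the
order of the arguments used here it is `⟨Z^{σ_n}, Z^{σ_m}⟩_μ`, as in the definition of a Gram
matrix of vectors for an inner product that is linear in the second variable. -/
def natKernel (m n : ℕ) : ℂ := μ.kernel (Word.nth d n) (Word.nth d m)

/-- The Verblunsky coefficients `γ_σ = γ_{∅,σ}`. -/
def verblunsky (σ : Word d) : ℂ := schurParameter μ.natKernel (Word.rank (1 : Word d)) σ.rank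

/-- The reverse polynomials `φ^#_σ` of the orthonormal polynomials: `φ^#_∅ = 1` and
`φ^#_{kσ} = (1 - |γ_{kσ}|²)^{-1/2} (- conj γ_{kσ} Z_k φ_σ + φ^#_{kσ-1})`. -/
def reverseOrthoPoly (hμ : μ.IsNontrivial) (σ : Word d) : NCPoly d :=
  match h : σ.toList with
  | [] => 1
  | k :: l =>
    ((defect (μ.verblunsky σ) : ℂ)⁻¹) •
      (-((starRingEnd ℂ) (μ.verblunsky σ) • (Z k * μ.orthoPoly hμ (Word.ofList l))) +
        reverseOrthoPoly hμ σ.pred)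
termination_by σ
decreasing_by
  have hs : σ = Word.letter k * Word.ofList l :=
    Word.toList_injective h
  rw [hs]
  exact Word.pred_letter_mul_lt k _

theorem reverseOrthoPoly_one (hμ : μ.IsNontrivial) : μ.reverseOrthoPoly hμ 1 = 1 := by
  rw [reverseOrthoPoly]
  rfl

theorem reverseOrthoPoly_letter_mul (hμ : μ.IsNontrivial) (k : Fin d) (σ : Word d) :
    μ.reverseOrthoPoly hμ (Word.letter k * σ) =
      ((defect (μ.verblunsky (Word.letter k * σ)) : ℂ)⁻¹) •
        (-((starRingEnd ℂ) (μ.verblunsky (Word.letter k * σ)) • (Z k * μ.orthoPoly hμ σ)) +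
          μ.reverseOrthoPoly hμ (Word.letter k * σ).pred) := by
  rw [reverseOrthoPoly]
  rfl

/-- The reverse polynomials `Φ^#_σ = φ^#_σ / a_{σ,σ}` of the monic orthogonal polynomials. -/
def reverseMonicPoly (hμ : μ.IsNontrivial) (σ : Word d) : NCPoly d :=
  (μ.a hμ σ σ)⁻¹ • μ.reverseOrthoPoly hμ σ

end NCMeasure

end NCSzego

end

/-!
The Szegő recurrences are steps of the Gram-Schmidt process in which two residuals are updated at
once. Let `e 0, e 1, …` be linearly independent unit vectors. Write `h` for the normalised residual
of `e k` against `e (k + 1), …, e (k + n)` and `g` for that of `e (k + n + 1)` against the same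
vectors, and put `z = ⟨h, g⟩`. Then `|z| < 1`, and `(h - conj z g) / √(1 - |z|²)` and
`(g - z h) / √(1 - |z|²)` are the residuals of `e k` and `e (k + n + 1)` against one more vector
(`IsResidual.step`). Defining `bwd` and `fwd` by this recursion yields, for every interval of
vectors, the residuals of its first and of its last member against the others.

The numbers `z` are the Schur parameters of the Gram kernel `⟨e k, e j⟩`
(`schurParameter_eq_partialCorr`). Indeed, unrolling the recursion expands `e k` in the orthonormal
forward residuals of the vectors strictly between `e k` and `e j`, with the row `L` as coordinates,
and `e j` in their backward residuals, with the column `C` as coordinates (`eq_sum_schurRow`,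
`eq_sum_schurColumn`), while the generalised rotation `U` is the change of coordinates between the
two orthonormal families (`sum_generalRotation`). Hence `L U C` is the inner product of the
projections of `e k` and `e j` to the span of the vectors in between, and what remains is the
product of the lengths of the two residuals and `z`.

For the monomials in the shortlex order, the forward residuals from position `0` are the orthonormal
polynomials. The left shifts are isometries with pairwise orthogonal ranges, so `Z_k φ_σ` is
orthogonal to all monomials strictly between `1` and `Z^{kσ}`: it is the forward residual from
position `1` (`isResidual_Z_mul_orthoPoly`). The recursion for the forward residuals is then the
recurrence for `φ_{kσ}`, and that for the backward residuals is the defining recursion of the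
reverse polynomials (`bwd_rank_zero`). Comparing leading coefficients gives
`√(1 - |γ_{kσ}|²) a_{kσ,kσ} = a_{σ,σ}`, and this turns the orthonormal recurrences into the monic
ones.
-/

noncomputable section

namespace NCSzego

/-! ### Normalised residuals -/

theorem norm_eq_one_of_inner_self {E : Type*} [NormedAddCommGroup E] [InnerProductSpace ℂ E]
    {u : E} (h : inner ℂ u u = (1 : ℂ)) : ‖u‖ = 1 := by
  rw [norm_eq_sqrt_re_inner (𝕜 := ℂ), h]
  simp

section Residual

variable {E : Type*} [NormedAddCommGroup E] [InnerProductSpace ℂ E] {ι : Type*}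

/-- `u` is the normalised residual of `e i` against the `e m`, `m ∈ s`: the unit vector orthogonal
to all of these that differs from a positive multiple of `e i` by a combination of them. -/
structure IsResidual (e : ι → E) (i : ι) (s : Set ι) (u : E) : Prop where
  norm_eq : ‖u‖ = 1
  inner_eq : ∀ m ∈ s, inner ℂ (e m) u = 0
  lead : ∃ c : ℝ, 0 < c ∧ u - (c : ℂ) • e i ∈ Submodule.span ℂ (e '' s)

variable {e : ι → E} {i j : ι} {s : Set ι} {u v : E}

theorem IsResidual.inner_mem (hu : IsResidual e i s u) {x : E}
    (hx : x ∈ Submodule.span ℂ (e '' s)) : inner ℂ x u = 0 := by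
  induction hx using Submodule.span_induction with
  | mem x hx =>
    obtain ⟨m, hm, rfl⟩ := hx
    exact hu.inner_eq m hm
  | zero => exact inner_zero_left _
  | add x y _ _ hx hy => rw [inner_add_left, hx, hy, add_zero]
  | smul a x _ hx => rw [inner_smul_left, hx, mul_zero]

theorem IsResidual.mem_span (hu : IsResidual e i s u) {t : Set ι} (hi : i ∈ t) (hs : s ⊆ t) :
    u ∈ Submodule.span ℂ (e '' t) := by
  obtain ⟨c, -, h⟩ := hu.lead
  rw [← sub_add_cancel u ((c : ℂ) • e i)]
  exact add_mem (Submodule.span_mono (Set.image_mono hs) h)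
    (Submodule.smul_mem _ _ (Submodule.subset_span ⟨i, hi, rfl⟩))

/-- Two residuals of the same data are positive multiples of each other modulo, and orthogonal
to, the same subspace. -/
theorem IsResidual.unique (hu : IsResidual e i s u) (hv : IsResidual e i s v) : u = v := by
  obtain ⟨a, ha, h1⟩ := hu.lead
  obtain ⟨b, hb, h2⟩ := hv.lead
  have hw : (b : ℂ) • u - (a : ℂ) • v ∈ Submodule.span ℂ (e '' s) := by
    have h := sub_mem (Submodule.smul_mem _ (b : ℂ) h1) (Submodule.smul_mem _ (a : ℂ) h2)
    convert h using 1
    module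
  have h0 : (b : ℂ) • u - (a : ℂ) • v = 0 := by
    refine inner_self_eq_zero (𝕜 := ℂ).1 ?_
    rw [inner_sub_right, inner_smul_right, inner_smul_right, hu.inner_mem hw, hv.inner_mem hw]
    simp
  have h3 := sub_eq_zero.1 h0
  have h4 : b = a := by
    have := congrArg norm h3
    simpa [norm_smul, hu.norm_eq, hv.norm_eq, abs_of_pos ha, abs_of_pos hb] using this
  subst h4
  exact smul_right_injective E (by exact_mod_cast hb.ne') h3

theorem IsResidual.inner_self (hu : IsResidual e i s u) : inner ℂ u u = 1 := by
  rw [inner_self_eq_norm_sq_to_K, hu.norm_eq]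
  simp

theorem defect_conj (z : ℂ) : defect ((starRingEnd ℂ) z) = defect z := by
  simp [defect]

theorem defect_pos {z : ℂ} (hz : ‖z‖ < 1) : 0 < defect z :=
  Real.sqrt_pos.2 (by nlinarith [norm_nonneg z])

theorem defect_mul_self {z : ℂ} (hz : ‖z‖ < 1) :
    (defect z : ℂ) * defect z = 1 - z * (starRingEnd ℂ) z := by
  rw [Complex.mul_conj, Complex.normSq_eq_norm_sq, ← Complex.ofReal_mul, defect,
    Real.mul_self_sqrt (by nlinarith [norm_nonneg z])]
  push_cast
  rfl

/-- Two residuals against the same vectors have an inner product `z` with `‖z‖ < 1`, and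
subtracting from one its component along the other gives the residual against one more vector. -/
theorem IsResidual.step (he : LinearIndependent ℂ e) (hu : IsResidual e i s u)
    (hv : IsResidual e j s v) (hij : i ≠ j) (his : i ∉ s) :
    ‖inner ℂ u v‖ < 1 ∧
      IsResidual e i (insert j s)
        ((defect (inner ℂ u v) : ℂ)⁻¹ • (u - (starRingEnd ℂ) (inner ℂ u v) • v)) := by
  set z := inner ℂ u v with hz
  set w := u - (starRingEnd ℂ) z • v with hw
  obtain ⟨c, hc, hcu⟩ := hu.lead
  obtain ⟨b, hb, hbv⟩ := hv.lead
  have hvt := hv.mem_span (Set.mem_insert j s) (Set.subset_insert j s)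
  have hlead : w - (c : ℂ) • e i ∈ Submodule.span ℂ (e '' insert j s) := by
    have h := sub_mem (Submodule.span_mono (Set.image_mono (Set.subset_insert j s)) hcu)
      (Submodule.smul_mem _ ((starRingEnd ℂ) z) hvt)
    convert h using 1
    rw [hw]
    abel
  have hw0 : w ≠ 0 := by
    intro h0
    rw [h0, zero_sub, neg_mem_iff,
      Submodule.smul_mem_iff _ (by exact_mod_cast hc.ne' : (c : ℂ) ≠ 0)] at hlead
    exact he.notMem_span_image (by simp [hij, his]) hlead
  have hvw : inner ℂ v w = 0 := by
    rw [hw, inner_sub_right, inner_smul_right, hv.inner_self, hz, inner_conj_symm, mul_one,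
      sub_self]
  have hww : inner ℂ w w = 1 - z * (starRingEnd ℂ) z := by
    nth_rw 1 [hw]
    rw [inner_sub_left, inner_smul_left, hvw, mul_zero, sub_zero, hw, inner_sub_right,
      inner_smul_right, hu.inner_self, ← hz, mul_comm]
  have hnorm : ‖w‖ ^ 2 = 1 - ‖z‖ ^ 2 := by
    rw [inner_self_eq_norm_sq_to_K, Complex.mul_conj, Complex.normSq_eq_norm_sq] at hww
    apply Complex.ofReal_injective
    push_cast at hww ⊢
    exact hww
  have hz1 : ‖z‖ < 1 := by
    have := pow_pos (norm_pos_iff.2 hw0) 2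
    nlinarith [norm_nonneg z]
  have hd : ‖w‖ = defect z := by rw [defect, ← hnorm, Real.sqrt_sq (norm_nonneg _)]
  have hdp := defect_pos hz1
  refine ⟨hz1, ?_, ?_, (defect z)⁻¹ * c, by positivity, ?_⟩
  · rw [norm_smul, hd, norm_inv, Complex.norm_real, Real.norm_of_nonneg hdp.le,
      inv_mul_cancel₀ hdp.ne']
  · intro m hm
    rw [inner_smul_right]
    suffices inner ℂ (e m) w = 0 by rw [this, mul_zero]
    have hs : ∀ x ∈ Submodule.span ℂ (e '' s), inner ℂ x w = 0 := fun x hx => by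
      rw [hw, inner_sub_right, inner_smul_right, hu.inner_mem hx, hv.inner_mem hx]
      simp
    rcases hm with rfl | hm
    · -- `e m` is, up to a factor, `v` plus a combination of the vectors in `s`
      have h := hs _ hbv
      rw [inner_sub_left, hvw, zero_sub, neg_eq_zero, inner_smul_left] at h
      exact (mul_eq_zero.1 h).resolve_left (by simpa using hb.ne')
    · exact hs _ (Submodule.subset_span ⟨m, hm, rfl⟩)
  · have h := Submodule.smul_mem _ (defect z : ℂ)⁻¹ hlead
    convert h using 1
    push_cast
    module

theorem IsResidual.comp_iff {κ : Type*} {f : κ → ι} {i : κ} {s : Set κ} :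
    IsResidual (e ∘ f) i s u ↔ IsResidual e (f i) (f '' s) u := by
  constructor
  · rintro ⟨h1, h2, h3⟩
    refine ⟨h1, ?_, ?_⟩
    · rintro _ ⟨m, hm, rfl⟩
      exact h2 m hm
    · rwa [← Set.image_comp]
  · rintro ⟨h1, h2, h3⟩
    refine ⟨h1, fun m hm => h2 _ ⟨m, hm, rfl⟩, ?_⟩
    rwa [← Set.image_comp] at h3

end Residual

/-! ### The Schur parameters of a Gram kernel -/

section Gram

variable {E : Type*} [NormedAddCommGroup E] [InnerProductSpace ℂ E]

/-- The pair of the backward and the forward residual: for linearly independent unit vectors `e`,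
the normalised residuals of `e k` against `e (k + 1), …, e (k + n)` and of `e (k + n)` against
`e k, …, e (k + n - 1)`. They are computed by the Szegő (Levinson) recursion on the number of
vectors. -/
def residualPair (e : ℕ → E) : ℕ → ℕ → E × E
  | 0, k => (e k, e k)
  | n + 1, k =>
    let h := (residualPair e n k).1
    let g := (residualPair e n (k + 1)).2
    let z : ℂ := inner ℂ h g
    ((defect z : ℂ)⁻¹ • (h - (starRingEnd ℂ) z • g), (defect z : ℂ)⁻¹ • (g - z • h))

/-- The normalised residual of `e k` against `e (k + 1), …, e (k + n)`. -/
def bwd (e : ℕ → E) (n k : ℕ) : E := (residualPair e n k).1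

/-- The normalised residual of `e (k + n)` against `e k, …, e (k + n - 1)`. -/
def fwd (e : ℕ → E) (n k : ℕ) : E := (residualPair e n k).2

/-- The partial correlation of `e k` and `e (k + 1 + n)`, given the vectors in between. -/
def partialCorr (e : ℕ → E) (k n : ℕ) : ℂ := inner ℂ (bwd e n k) (fwd e n (k + 1))

variable {e : ℕ → E}

theorem bwd_succ (n k : ℕ) : bwd e (n + 1) k =
    (defect (partialCorr e k n) : ℂ)⁻¹ •
      (bwd e n k - (starRingEnd ℂ) (partialCorr e k n) • fwd e n (k + 1)) := rfl

theorem fwd_succ (n k : ℕ) : fwd e (n + 1) k =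
    (defect (partialCorr e k n) : ℂ)⁻¹ •
      (fwd e n (k + 1) - partialCorr e k n • bwd e n k) := rfl

variable (he : LinearIndependent ℂ e) (hn : ∀ k, ‖e k‖ = 1)

include he hn

theorem isResidual_bwd_fwd (n k : ℕ) :
    IsResidual e k (Set.Ioc k (k + n)) (bwd e n k) ∧
      IsResidual e (k + n) (Set.Ico k (k + n)) (fwd e n k) := by
  induction n generalizing k with
  | zero =>
    constructor <;>
    · refine ⟨hn k, by simp, 1, one_pos, ?_⟩
      simp [bwd, fwd, residualPair]
  | succ n ih =>
    have h1 := (ih k).1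
    have h2 := (ih (k + 1)).2
    have hs : Set.Ico (k + 1) (k + 1 + n) = Set.Ioc k (k + n) := by
      ext; simp; omega
    rw [hs] at h2
    refine ⟨?_, ?_⟩
    · have h := (h1.step he h2 (by omega) (by simp)).2
      have hI : Set.Ioc k (k + (n + 1)) = insert (k + 1 + n) (Set.Ioc k (k + n)) := by
        ext; simp; omega
      rw [hI]
      exact h
    · have h := (h2.step he h1 (by omega) (by simp)).2
      rw [← inner_conj_symm, defect_conj, Complex.conj_conj] at h
      have hI : Set.Ico k (k + (n + 1)) = insert k (Set.Ioc k (k + n)) := by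
        ext; simp; omega
      rw [hI, show k + (n + 1) = k + 1 + n by omega]
      exact h

theorem norm_partialCorr_lt_one (k n : ℕ) : ‖partialCorr e k n‖ < 1 := by
  have h1 := (isResidual_bwd_fwd he hn n k).1
  have h2 := (isResidual_bwd_fwd he hn n (k + 1)).2
  have hs : Set.Ico (k + 1) (k + 1 + n) = Set.Ioc k (k + n) := by
    ext; simp; omega
  rw [hs] at h2
  exact (h1.step he h2 (by omega) (by simp)).1

theorem inner_fwd_fwd (k : ℕ) {p q : ℕ} :
    inner ℂ (fwd e p k) (fwd e q k) = if p = q then 1 else 0 := by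
  have h : ∀ {p q : ℕ}, p < q → inner ℂ (fwd e p k) (fwd e q k) = (0 : ℂ) := fun {p q} hpq =>
    (isResidual_bwd_fwd he hn q k).2.inner_mem ((isResidual_bwd_fwd he hn p k).2.mem_span
      (by simp; omega) (fun x hx => by simp at hx ⊢; omega))
  rcases lt_trichotomy p q with hpq | rfl | hpq
  · rw [if_neg hpq.ne, h hpq]
  · rw [if_pos rfl, (isResidual_bwd_fwd he hn p k).2.inner_self]
  · rw [if_neg hpq.ne', ← inner_conj_symm, h hpq, map_zero]

theorem inner_fwd_bwd (k : ℕ) {p n : ℕ} (h : p < n) :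
    inner ℂ (fwd e p (k + 1)) (bwd e n k) = (0 : ℂ) :=
  (isResidual_bwd_fwd he hn n k).1.inner_mem ((isResidual_bwd_fwd he hn p (k + 1)).2.mem_span
      (by simp; omega) (fun x hx => by simp at hx ⊢; omega))

theorem defect_smul_bwd_succ (n k : ℕ) : (defect (partialCorr e k n) : ℂ) • bwd e (n + 1) k =
    bwd e n k - (starRingEnd ℂ) (partialCorr e k n) • fwd e n (k + 1) := by
  have h := (defect_pos (norm_partialCorr_lt_one he hn k n)).ne'
  rw [bwd_succ, smul_inv_smul₀ (by exact_mod_cast h)]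

theorem defect_smul_fwd_succ (n k : ℕ) : (defect (partialCorr e k n) : ℂ) • fwd e (n + 1) k =
    fwd e n (k + 1) - partialCorr e k n • bwd e n k := by
  have h := (defect_pos (norm_partialCorr_lt_one he hn k n)).ne'
  rw [fwd_succ, smul_inv_smul₀ (by exact_mod_cast h)]

/-- The elementary rotation takes coordinates with respect to the orthonormal pair
`fwd e n (k + 1), bwd e (n + 1) k` to those with respect to `bwd e n k, fwd e (n + 1) k`. -/
theorem rotation_smul_add (k n : ℕ) (a b : ℂ) :
    (partialCorr e k n * a + defect (partialCorr e k n) * b) • bwd e n k +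
      (defect (partialCorr e k n) * a - (starRingEnd ℂ) (partialCorr e k n) * b) •
        fwd e (n + 1) k = a • fwd e n (k + 1) + b • bwd e (n + 1) k := by
  have hz := norm_partialCorr_lt_one he hn k n
  have hd : (defect (partialCorr e k n) : ℂ) ≠ 0 := by exact_mod_cast (defect_pos hz).ne'
  have hdd := defect_mul_self hz
  rw [bwd_succ, fwd_succ]
  set z := partialCorr e k n
  set D : ℂ := (defect z : ℂ)
  match_scalars
  · field_simp
    linear_combination b * hdd
  · field_simp
    ring

omit he hn in
theorem rotations_apply_of_lt (T : ℕ → ℕ → ℂ) (k n : ℕ) (x : ℕ → ℂ) {p : ℕ} (hp : n < p) :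
    rotations T k n x p = x p := by
  induction n generalizing x with
  | zero => rfl
  | succ n ih =>
    rw [rotations, ih _ (by omega), rotation, if_neg (by omega), if_neg (by omega)]

omit he hn in
theorem generalRotation_apply_of_lt (T : ℕ → ℕ → ℂ) (k n : ℕ) (x : ℕ → ℂ) {p : ℕ} (hp : n < p) :
    generalRotation T k n x p = x p := by
  induction n generalizing k with
  | zero => rfl
  | succ n ih => rw [generalRotation, rotations_apply_of_lt _ _ _ _ hp, ih _ (by omega)]

variable {T : ℕ → ℕ → ℂ} {n : ℕ} (hT : ∀ k m, m < n → T k (k + 1 + m) = partialCorr e k m)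

include hT

theorem sum_rotations (k : ℕ) (x : ℕ → ℂ) {N : ℕ} (hN : N ≤ n) :
    ∑ p ∈ Finset.range (N + 1), rotations T k N x p • fwd e p k =
      ∑ p ∈ Finset.range N, x p • fwd e p (k + 1) + x N • bwd e N k := by
  induction N generalizing x with
  | zero => simp [rotations, bwd, fwd, residualPair]
  | succ N ih =>
    rw [Finset.sum_range_succ, rotations, ih _ (by omega),
      rotations_apply_of_lt _ _ _ _ (Nat.lt_succ_self N), Finset.sum_range_succ _ N,
      hT k N (by omega), add_assoc (Finset.sum _ _), add_assoc (Finset.sum _ _),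
      ← rotation_smul_add he hn k N]
    congr 1
    · refine Finset.sum_congr rfl fun p hp => ?_
      have := Finset.mem_range.1 hp
      rw [rotation, if_neg (by omega), if_neg (by omega)]
    · simp [rotation]

/-- `U_{k,k+m}` takes coordinates with respect to the backward residuals to those with respect to
the forward residuals. -/
theorem sum_generalRotation (k : ℕ) (x : ℕ → ℂ) {m : ℕ} (hm : m ≤ n) :
    ∑ p ∈ Finset.range (m + 1), generalRotation T k m x p • fwd e p k =
      ∑ p ∈ Finset.range (m + 1), x p • bwd e p (k + m - p) := by
  induction m generalizing k with
  | zero => simp [generalRotation, bwd, fwd, residualPair]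
  | succ m ih =>
    rw [generalRotation, sum_rotations he hn hT _ _ hm, ih _ (by omega),
      generalRotation_apply_of_lt _ _ _ _ (Nat.lt_succ_self m), Finset.sum_range_succ _ (m + 1)]
    congr 1
    · refine Finset.sum_congr rfl fun p _ => ?_
      congr 2
      omega
    · congr 2
      omega

omit he hn hT in
theorem Ioo_add_one_eq_empty (k : ℕ) : Finset.Ioo k (k + 1) = ∅ := by
  ext; simp

/-- The row `L` consists of the conjugate coordinates of `e k` with respect to the forward
residuals of the vectors after it. -/
theorem eq_sum_schurRow (k : ℕ) {m : ℕ} (hm : m ≤ n) :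
    e k = ∑ p ∈ Finset.range m, (starRingEnd ℂ) (schurRow T k p) • fwd e p (k + 1) +
      (∏ l ∈ Finset.Ioo k (k + 1 + m), (defect (T k l) : ℂ)) • bwd e m k := by
  induction m with
  | zero => simp [bwd, residualPair, Ioo_add_one_eq_empty]
  | succ m ih =>
    have hI : Finset.Ioo k (k + 1 + (m + 1)) = insert (k + 1 + m) (Finset.Ioo k (k + 1 + m)) := by
      ext; simp; omega
    rw [hI, Finset.prod_insert (by simp), hT k m (by omega), mul_comm, mul_smul,
      defect_smul_bwd_succ he hn, Finset.sum_range_succ, schurRow, hT k m (by omega)]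
    conv_lhs => rw [ih (by omega)]
    rw [map_mul, map_prod]
    simp only [Complex.conj_ofReal]
    module

/-- The column `C` consists of the coordinates of `e (k + 1 + m)` with respect to the backward
residuals of the vectors before it. -/
theorem eq_sum_schurColumn (k : ℕ) {m : ℕ} (hm : m ≤ n) :
    e (k + 1 + m) =
      ∑ p ∈ Finset.range m, schurColumn T (k + 1 + m) p • bwd e p (k + m - p) +
      (∏ l ∈ Finset.Ioo k (k + 1 + m), (defect (T l (k + 1 + m)) : ℂ)) • fwd e m (k + 1) := by
  induction m generalizing k with
  | zero => simp [fwd, residualPair, Ioo_add_one_eq_empty]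
  | succ m ih =>
    have hI : Finset.Ioo k (k + 1 + (m + 1)) =
        insert (k + 1) (Finset.Ioo (k + 1) (k + 1 + (m + 1))) := by
      ext; simp
    have hj : k + 1 + 1 + m = k + 1 + (m + 1) := by omega
    have h := ih (k + 1) (by omega)
    have hTj := hT (k + 1) m (by omega)
    rw [hj] at h hTj
    rw [hI, Finset.prod_insert (by simp), mul_comm, mul_smul, hTj, defect_smul_fwd_succ he hn,
      Finset.sum_range_succ, schurColumn]
    have e1 : k + 1 + (m + 1) - 1 - m = k + 1 := by omega
    have e2 : k + (m + 1) - m = k + 1 := by omega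
    have e3 : k + 1 + m = k + (m + 1) := by omega
    rw [e1, e2, hTj]
    rw [e3] at h
    conv_lhs => rw [h]
    module

/-- The Schur parametrisation of the Gram kernel of the sequence `e`. Only the entries of the
table at distance at most `n` enter, so `T` may be a table that is still being computed. -/
theorem inner_eq_schurCentre_add (k : ℕ) :
    inner ℂ (e k) (e (k + 1 + n)) =
      schurCentre T k (k + 1 + n) + schurRadius T k (k + 1 + n) * partialCorr e k n := by
  have hcol : ∑ p ∈ Finset.range n, schurColumn T (k + 1 + n) p • bwd e p (k + n - p) =
      ∑ p ∈ Finset.range n,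
        generalRotation T (k + 1) (n - 1) (schurColumn T (k + 1 + n)) p • fwd e p (k + 1) := by
    cases n with
    | zero => simp
    | succ m =>
      rw [Nat.add_sub_cancel, sum_generalRotation he hn hT _ _ (Nat.le_succ m)]
      refine Finset.sum_congr rfl fun p _ => ?_
      congr 2
      omega
  have h1 := eq_sum_schurRow he hn hT k le_rfl
  have h2 := eq_sum_schurColumn he hn hT k le_rfl
  rw [hcol] at h2
  have e1 : k + 1 + n - k - 1 = n := by omega
  have e2 : k + 1 + n - k - 2 = n - 1 := by omega
  rw [schurCentre, schurRadius, e1, e2]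
  set c := generalRotation T (k + 1) (n - 1) (schurColumn T (k + 1 + n))
  set r := schurRow T k
  rw [h1, h2]
  have z1 : inner ℂ (bwd e n k) (∑ p ∈ Finset.range n, c p • fwd e p (k + 1)) = 0 := by
    rw [inner_sum]
    refine Finset.sum_eq_zero fun p hp => ?_
    rw [inner_smul_right, ← inner_conj_symm, inner_fwd_bwd he hn k (Finset.mem_range.1 hp),
      map_zero, mul_zero]
  have z2 : inner ℂ (∑ p ∈ Finset.range n, (starRingEnd ℂ) (r p) • fwd e p (k + 1))
      (fwd e n (k + 1)) = 0 := by
    rw [sum_inner]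
    refine Finset.sum_eq_zero fun p hp => ?_
    rw [inner_smul_left, inner_fwd_fwd he hn, if_neg (Finset.mem_range.1 hp).ne, mul_zero]
  have ho : Orthonormal ℂ fun p => fwd e p (k + 1) :=
    orthonormal_iff_ite.2 fun p q => inner_fwd_fwd he hn (k + 1)
  rw [inner_add_left, inner_add_right, inner_add_right, inner_smul_left, inner_smul_left,
    inner_smul_right, inner_smul_right, z1, z2, ho.inner_sum, map_prod]
  simp only [Complex.conj_conj, Complex.conj_ofReal, partialCorr]
  push_cast
  ring

omit hT in
/-- The recursion on the distance of the indices recovers the partial correlations: at each step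
the entries computed so far determine the centre, and the radius does not vanish. -/
theorem schurTable_eq (n : ℕ) (k m : ℕ) (hm : m < n) :
    schurTable (fun k j => inner ℂ (e k) (e j)) n k (k + 1 + m) = partialCorr e k m := by
  induction n generalizing k m with
  | zero => omega
  | succ n ih =>
    rcases Nat.lt_succ_iff_lt_or_eq.1 hm with hm | rfl
    · simp only [schurTable]
      rw [if_neg (by omega), ih k m hm]
    · simp only [schurTable]
      rw [if_pos (by omega), inner_eq_schurCentre_add he hn ih, add_sub_cancel_left]
      refine mul_div_cancel_left₀ _ ?_
      -- all the defects in the radius are positive, as they belong to partial correlations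
      have hd : ∀ i j, i < j → j ≤ i + m →
          defect (schurTable (fun k j => inner ℂ (e k) (e j)) m i j) ≠ 0 := by
        intro i j hij hj
        obtain ⟨l, rfl⟩ := Nat.exists_eq_add_of_lt hij
        rw [show i + l + 1 = i + 1 + l by omega, ih i l (by omega)]
        exact (defect_pos (norm_partialCorr_lt_one he hn i l)).ne'
      rw [schurRadius]
      norm_cast
      refine mul_ne_zero (Finset.prod_ne_zero_iff.2 fun l hl => ?_)
        (Finset.prod_ne_zero_iff.2 fun l hl => ?_) <;>
      · have := Finset.mem_Ioo.1 hl
        exact hd _ _ (by omega) (by omega)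

omit hT in
/-- The Schur parameters of a Gram kernel are the partial correlations. -/
theorem schurParameter_eq_partialCorr (k m : ℕ) :
    schurParameter (fun k j => inner ℂ (e k) (e j)) k (k + 1 + m) = partialCorr e k m := by
  rw [schurParameter]
  exact schurTable_eq he hn _ k m (by omega)

end Gram

/-! ### Gram-Schmidt vectors as residuals -/

section GramSchmidt

open InnerProductSpace

variable {E : Type*} [NormedAddCommGroup E] [InnerProductSpace ℂ E] {ι : Type*} [LinearOrder ι]
  [LocallyFiniteOrderBot ι] [WellFoundedLT ι]

theorem gramSchmidt_sub_mem_span (e : ι → E) (i : ι) :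
    gramSchmidt ℂ e i - e i ∈ Submodule.span ℂ (e '' Set.Iio i) := by
  rw [gramSchmidt_def, sub_sub_cancel_left, neg_mem_iff, ← span_gramSchmidt_Iio ℂ e i]
  refine Submodule.sum_mem _ fun j hj => ?_
  rw [Submodule.starProjection_singleton]
  exact Submodule.smul_mem _ _ (Submodule.subset_span ⟨j, Finset.mem_Iio.1 hj, rfl⟩)

theorem isResidual_gramSchmidtNormed {e : ι → E} (he : LinearIndependent ℂ e) (i : ι) :
    IsResidual e i (Set.Iio i) (gramSchmidtNormed ℂ e i) := by
  have h0 := norm_pos_iff.2 (gramSchmidt_ne_zero i he)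
  refine ⟨gramSchmidtNormed_unit_length i he, fun m hm => ?_, ‖gramSchmidt ℂ e i‖⁻¹,
    by positivity, ?_⟩
  · rw [gramSchmidtNormed, inner_smul_right, ← inner_conj_symm,
      gramSchmidt_inv_triangular ℂ e hm, map_zero, mul_zero]
  · have h := Submodule.smul_mem _ (‖gramSchmidt ℂ e i‖ : ℂ)⁻¹ (gramSchmidt_sub_mem_span e i)
    rw [smul_sub] at h
    rw [Complex.ofReal_inv]
    exact h

end GramSchmidt

/-! ### The enumeration of words -/

namespace Word

variable {d : ℕ}

theorem letter_mul_lt_letter_mul (k : Fin d) {σ τ : Word d} :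
    letter k * σ < letter k * τ ↔ σ < τ := by
  simp [lt_iff]

theorem one_le (σ : Word d) : 1 ≤ σ := by
  induction σ using Word.induction with
  | one => exact le_rfl
  | letter_mul k σ _ => exact (one_lt_letter_mul k σ).le

theorem rank_one : rank (1 : Word d) = 0 := by
  rw [rank, Finset.card_eq_zero, Finset.eq_empty_iff_forall_notMem]
  exact fun σ hσ => (one_le σ).not_gt (Finset.mem_Iio.1 hσ)

theorem rank_strictMono : StrictMono (rank : Word d → ℕ) := fun σ τ h =>
  Finset.card_lt_card (Finset.ssubset_iff_of_subset (Finset.Iio_subset_Iio h.le)|>.2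
    ⟨σ, Finset.mem_Iio.2 h, by simp⟩)

theorem rank_letter_mul (k : Fin d) (σ : Word d) :
    rank (letter k * σ) = rank (pred (letter k * σ)) + 1 := by
  have h : (Finset.Iio (letter k * σ)).Nonempty := ⟨1, Finset.mem_Iio.2 (one_lt_letter_mul k σ)⟩
  have h1 := pred_letter_mul_lt k σ
  have h2 : Finset.Iio (letter k * σ) =
      insert (pred (letter k * σ)) (Finset.Iio (pred (letter k * σ))) := by
    ext τ
    rw [Finset.mem_insert, Finset.mem_Iio, Finset.mem_Iio, ← le_iff_eq_or_lt]
    refine ⟨fun hτ => ?_, fun hτ => hτ.trans_lt h1⟩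
    rw [pred, dif_pos h]
    exact Finset.le_max' _ _ (Finset.mem_Iio.2 hτ)
  rw [rank, h2, Finset.card_insert_of_notMem (by simp), rank]

theorem rank_surjective (hd : 0 < d) : Function.Surjective (rank : Word d → ℕ) := by
  intro n
  have : Nonempty (Fin d) := ⟨⟨0, hd⟩⟩
  have : Infinite (Word d) := inferInstanceAs (Infinite (List (Fin d)))
  obtain ⟨_, ⟨σ, rfl⟩, hσ⟩ :=
    (Set.infinite_range_of_injective (rank_strictMono (d := d)).injective).exists_gt n
  -- `rank` maps the `rank σ` words before `σ` injectively, hence bijectively, to the numbers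
  -- below `rank σ`
  have h : (Finset.Iio σ).image rank = Finset.range (rank σ) := by
    refine Finset.eq_of_subset_of_card_le ?_ ?_
    · intro m hm
      obtain ⟨τ, hτ, rfl⟩ := Finset.mem_image.1 hm
      exact Finset.mem_range.2 (rank_strictMono (Finset.mem_Iio.1 hτ))
    · rw [Finset.card_image_of_injective _ rank_strictMono.injective, Finset.card_range, rank]
  obtain ⟨τ, -, hτ⟩ := Finset.mem_image.1 (h ▸ Finset.mem_range.2 hσ)
  exact ⟨τ, hτ⟩

theorem nth_rank (σ : Word d) : nth d (rank σ) = σ :=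
  Function.leftInverse_invFun rank_strictMono.injective σ

/-- For a nonempty alphabet, the words in the shortlex order form a copy of `ℕ`. -/
def nthIso {d : ℕ} (hd : 0 < d) : ℕ ≃o Word d :=
  (rank_strictMono.orderIsoOfSurjective _ (rank_surjective hd)).symm

theorem coe_nthIso (hd : 0 < d) : ⇑(nthIso hd) = nth d := by
  funext n
  obtain ⟨σ, rfl⟩ := rank_surjective hd n
  rw [nth_rank]
  exact rank_strictMono.orderIsoOfSurjective_symm_apply_self _ _ σ

theorem nth_zero : nth d 0 = 1 := by
  rw [← rank_one (d := d), nth_rank]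

end Word

/-! ### Shifting residuals by an indeterminate -/

theorem adjoint_shiftPow_mul_shiftPow_self {d : ℕ} (σ : Word d) :
    ContinuousLinearMap.adjoint (shiftPow σ) * shiftPow σ = 1 := by
  induction σ using Word.induction with
  | one => rw [map_one, ← ContinuousLinearMap.star_eq_adjoint, star_one, one_mul]
  | letter_mul k σ ih =>
    have h := adjoint_leftShift_mul k k
    rw [if_pos rfl] at h
    rw [← ContinuousLinearMap.star_eq_adjoint] at h ih ⊢
    rw [shiftPow_letter_mul, star_mul, mul_assoc, ← mul_assoc _ _ (shiftPow σ), h, one_mul, ih]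

theorem evalShift_Z_mul {d : ℕ} (k : Fin d) (P : NCPoly d) :
    evalShift (Z k * P) = leftShift k * evalShift P := by
  rw [map_mul]
  congr 1
  have h := shiftPow_letter_mul k (1 : Word d)
  rw [map_one, mul_one, mul_one] at h
  simp [evalShift, Z, monomial, h]

theorem monomial_letter_mul {d : ℕ} (k : Fin d) (σ : Word d) :
    monomial (Word.letter k * σ) = Z k * monomial σ := by
  simp [monomial, Z]

theorem linearIndependent_monomial (d : ℕ) :
    LinearIndependent ℂ (monomial : Word d → NCPoly d) :=
  (MonoidAlgebra.basis (Word d) ℂ).linearIndependent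

theorem coeff_monomial {d : ℕ} (σ τ : Word d) :
    (monomial σ).coeff τ = if σ = τ then 1 else 0 := by
  classical
  simp [monomial, Finsupp.single_apply]

theorem coeff_eq_zero_of_mem_span {d : ℕ} {s : Set (Word d)} {P : NCPoly d}
    (hP : P ∈ Submodule.span ℂ (monomial '' s)) {σ : Word d} (hσ : σ ∉ s) : P.coeff σ = 0 := by
  induction hP using Submodule.span_induction with
  | mem P hP =>
    obtain ⟨τ, hτ, rfl⟩ := hP
    rw [coeff_monomial, if_neg]
    rintro rfl
    exact hσ hτ
  | zero => rfl
  | add P Q _ _ hP hQ => rw [MonoidAlgebra.coeff_add, Finsupp.add_apply, hP, hQ, add_zero]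
  | smul a P _ hP => rw [MonoidAlgebra.coeff_smul, Finsupp.smul_apply, hP, smul_zero]

theorem coeff_Z_mul {d : ℕ} (k : Fin d) (σ : Word d) (P : NCPoly d) :
    (Z k * P).coeff (Word.letter k * σ) = P.coeff σ := by
  rw [Z, monomial, MonoidAlgebra.of_apply, MonoidAlgebra.coeff_single_mul_mul, one_mul]

namespace NCMeasure

variable {d : ℕ} {μ : NCMeasure d}

theorem form_monomial_self (hμ1 : μ.IsProbability) (σ : Word d) :
    μ.form (monomial σ) (monomial σ) = 1 := by
  rw [form_monomial, ← hμ1, kernel]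
  congr 2
  exact adjoint_shiftPow_mul_shiftPow_self σ

theorem form_Z_mul_Z_mul (j k : Fin d) (P Q : NCPoly d) :
    μ.form (Z k * P) (Z j * Q) = if j = k then μ.form P Q else 0 := by
  have h : ContinuousLinearMap.adjoint (evalShift (Z j * Q)) * evalShift (Z k * P) =
      ContinuousLinearMap.adjoint (evalShift Q) *
        (ContinuousLinearMap.adjoint (leftShift j) * leftShift k) * evalShift P := by
    rw [evalShift_Z_mul, evalShift_Z_mul]
    simp only [← ContinuousLinearMap.star_eq_adjoint, star_mul, mul_assoc]
  rw [adjoint_leftShift_mul] at h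
  split_ifs with hjk
  · rw [if_pos hjk, mul_one] at h
    simp only [form, h]
  · rw [if_neg hjk, mul_zero, zero_mul] at h
    simp only [form, h]
    exact map_zero μ.toFun

/-- The norm on nc polynomials that comes from a non-trivial nc measure. -/
@[reducible] def normedGroup (hμ : μ.IsNontrivial) : NormedAddCommGroup (NCPoly d) :=
  (μ.core hμ).toNormedAddCommGroup

/-- The inner product on nc polynomials that comes from a non-trivial nc measure. -/
@[reducible] def innerSpace (hμ : μ.IsNontrivial) :
    letI := normedGroup hμ; InnerProductSpace ℂ (NCPoly d) :=
  letI := normedGroup hμ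
  InnerProductSpace.ofCore (μ.core hμ).toCore

theorem norm_monomial (hμ : μ.IsNontrivial) (hμ1 : μ.IsProbability) (σ : Word d) :
    letI := normedGroup hμ; ‖monomial σ‖ = 1 := by
  let _ := normedGroup hμ
  let _ := innerSpace hμ
  have h : inner ℂ (monomial σ) (monomial σ) = (1 : ℂ) := form_monomial_self hμ1 σ
  exact norm_eq_one_of_inner_self h

theorem isResidual_orthoPoly (hμ : μ.IsNontrivial) (σ : Word d) :
    letI := normedGroup hμ; letI := innerSpace hμ
    IsResidual monomial σ (Set.Iio σ) (μ.orthoPoly hμ σ) := by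
  let _ := normedGroup hμ
  let _ := innerSpace hμ
  exact isResidual_gramSchmidtNormed (linearIndependent_monomial d) σ

/-- As `L_k` is an isometry with range orthogonal to those of the other `L_j`, the polynomial
`Z_k φ_σ` is the residual of `Z^{kσ}` against all the earlier monomials except `1`. -/
theorem isResidual_Z_mul_orthoPoly (hμ : μ.IsNontrivial) (k : Fin d) (σ : Word d) :
    letI := normedGroup hμ; letI := innerSpace hμ
    IsResidual monomial (Word.letter k * σ) (Set.Ioo 1 (Word.letter k * σ))
      (Z k * μ.orthoPoly hμ σ) := by
  let _ := normedGroup hμ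
  let _ := innerSpace hμ
  have hu := isResidual_orthoPoly hμ σ
  refine ⟨?_, ?_, ?_⟩
  · have h : inner ℂ (Z k * μ.orthoPoly hμ σ) (Z k * μ.orthoPoly hμ σ) = (1 : ℂ) := by
      rw [← hu.inner_self]
      exact (form_Z_mul_Z_mul k k _ _).trans (if_pos rfl)
    exact norm_eq_one_of_inner_self h
  · intro τ hτ
    induction τ using Word.induction with
    | one => exact absurd hτ.1 (lt_irrefl _)
    | letter_mul j τ _ =>
      rw [monomial_letter_mul]
      refine (form_Z_mul_Z_mul j k _ _).trans ?_
      split_ifs with hjk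
      · subst hjk
        exact hu.inner_eq τ ((Word.letter_mul_lt_letter_mul j).1 hτ.2)
      · rfl
  · obtain ⟨c, hc, h⟩ := hu.lead
    refine ⟨c, hc, ?_⟩
    have h1 := Submodule.mem_map_of_mem (f := LinearMap.mulLeft ℂ (Z k)) h
    rw [Submodule.map_span, ← Set.image_comp, LinearMap.mulLeft_apply, mul_sub, mul_smul_comm,
      ← monomial_letter_mul] at h1
    refine Submodule.span_mono ?_ h1
    rintro _ ⟨τ, hτ, rfl⟩
    exact ⟨Word.letter k * τ, ⟨Word.one_lt_letter_mul k τ, (Word.letter_mul_lt_letter_mul k).2 hτ⟩,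
      monomial_letter_mul k τ⟩

/-! ### Passage to the enumerated monomials -/

/-- The monomials, enumerated in the shortlex order (for `d = 0` the sequence is constant). -/
def natMonomial (d : ℕ) : ℕ → NCPoly d := monomial ∘ Word.nth d

theorem linearIndependent_natMonomial (hd : 0 < d) (hμ : μ.IsNontrivial) :
    letI := normedGroup hμ; letI := innerSpace hμ; LinearIndependent ℂ (natMonomial d) := by
  have h := (linearIndependent_monomial d).comp _ (Word.nthIso hd).injective
  rwa [Word.coe_nthIso] at h

theorem norm_natMonomial (hμ : μ.IsNontrivial) (hμ1 : μ.IsProbability) (n : ℕ) :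
    letI := normedGroup hμ; ‖natMonomial d n‖ = 1 :=
  norm_monomial hμ hμ1 _

theorem fwd_eq_of_isResidual (hd : 0 < d) (hμ : μ.IsNontrivial) (hμ1 : μ.IsProbability)
    {n k : ℕ} {u : NCPoly d} :
    letI := normedGroup hμ; letI := innerSpace hμ
    IsResidual monomial (Word.nth d (k + n)) (Word.nth d '' Set.Ico k (k + n)) u →
    fwd (natMonomial d) n k = u := by
  let _ := normedGroup hμ
  let _ := innerSpace hμ
  intro hu
  exact (isResidual_bwd_fwd (e := natMonomial d)
    (linearIndependent_natMonomial hd hμ) (norm_natMonomial hμ hμ1) n k).2.unique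
    (IsResidual.comp_iff.2 hu)

theorem fwd_rank_zero (hd : 0 < d) (hμ : μ.IsNontrivial) (hμ1 : μ.IsProbability) (σ : Word d) :
    letI := normedGroup hμ; letI := innerSpace hμ
    fwd (natMonomial d) σ.rank 0 = μ.orthoPoly hμ σ := by
  refine fwd_eq_of_isResidual hd hμ hμ1 ?_
  have h : Word.nth d '' Set.Ico 0 (0 + σ.rank) = Set.Iio σ := by
    have hI : Set.Ico 0 (0 + σ.rank) = Set.Iio σ.rank := by ext; simp
    rw [hI, ← Word.coe_nthIso hd, OrderIso.image_Iio, Word.coe_nthIso, Word.nth_rank]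
  rw [h, zero_add, Word.nth_rank]
  exact isResidual_orthoPoly hμ σ

theorem fwd_rank_one (hd : 0 < d) (hμ : μ.IsNontrivial) (hμ1 : μ.IsProbability) (k : Fin d)
    (σ : Word d) :
    letI := normedGroup hμ; letI := innerSpace hμ
    fwd (natMonomial d) (Word.letter k * σ).pred.rank 1 =
      Z k * μ.orthoPoly hμ σ := by
  refine fwd_eq_of_isResidual hd hμ hμ1 ?_
  have hr : 1 + (Word.letter k * σ).pred.rank = (Word.letter k * σ).rank := by
    rw [Word.rank_letter_mul, add_comm]
  have h : Word.nth d '' Set.Ico 1 (Word.letter k * σ).rank = Set.Ioo 1 (Word.letter k * σ) := by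
    have hI : Set.Ico 1 (Word.letter k * σ).rank = Set.Ioo 0 (Word.letter k * σ).rank := by
      ext; simp [Nat.one_le_iff_ne_zero, Nat.pos_iff_ne_zero]
    rw [hI, ← Word.coe_nthIso hd, OrderIso.image_Ioo, Word.coe_nthIso, Word.nth_rank,
      Word.nth_zero]
  rw [hr, h, Word.nth_rank]
  exact isResidual_Z_mul_orthoPoly hμ k σ

theorem verblunsky_letter_mul (hd : 0 < d) (hμ : μ.IsNontrivial) (hμ1 : μ.IsProbability)
    (k : Fin d) (σ : Word d) :
    letI := normedGroup hμ; letI := innerSpace hμ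
    μ.verblunsky (Word.letter k * σ) =
      partialCorr (natMonomial d) 0 (Word.letter k * σ).pred.rank := by
  let _ := normedGroup hμ
  let _ := innerSpace hμ
  rw [← schurParameter_eq_partialCorr (e := natMonomial d)
    (linearIndependent_natMonomial hd hμ) (norm_natMonomial hμ hμ1), verblunsky,
    Word.rank_one, Word.rank_letter_mul]
  have h : μ.natKernel = fun k j =>
      inner ℂ (natMonomial d k) (natMonomial d j) := by
    funext k j
    exact (μ.form_monomial _ _).symm
  rw [h, zero_add, add_comm 1]

theorem norm_verblunsky_lt_one (hμ : μ.IsNontrivial) (hμ1 : μ.IsProbability) (σ : Word d) :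
    ‖μ.verblunsky σ‖ < 1 := by
  let _ := normedGroup hμ
  let _ := innerSpace hμ
  induction σ using Word.induction with
  | one => simp [verblunsky, schurParameter, schurTable]
  | letter_mul k σ _ =>
    rw [verblunsky_letter_mul k.pos hμ hμ1]
    exact norm_partialCorr_lt_one (e := natMonomial d)
      (linearIndependent_natMonomial k.pos hμ) (norm_natMonomial hμ hμ1) _ _

/-- The reverse polynomials are the residuals of `1` against the later monomials. -/
theorem bwd_rank_zero (hd : 0 < d) (hμ : μ.IsNontrivial) (hμ1 : μ.IsProbability) (σ : Word d) :
    letI := normedGroup hμ; letI := innerSpace hμ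
    bwd (natMonomial d) σ.rank 0 = μ.reverseOrthoPoly hμ σ := by
  let _ := normedGroup hμ
  let _ := innerSpace hμ
  induction σ using WellFoundedLT.induction with
  | ind σ ih =>
    cases σ using Word.induction with
    | one =>
      rw [Word.rank_one, reverseOrthoPoly_one]
      change monomial (Word.nth d 0) = 1
      rw [Word.nth_zero, monomial, map_one]
    | letter_mul k σ _ =>
      rw [Word.rank_letter_mul, bwd_succ, reverseOrthoPoly_letter_mul, zero_add,
        fwd_rank_one hd hμ hμ1, ih _ (Word.pred_letter_mul_lt k σ),
        ← verblunsky_letter_mul hd hμ hμ1, sub_eq_neg_add]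

/-! ### The recurrences -/

/-- The Szegő recurrence for the orthonormal polynomials. -/
theorem defect_smul_orthoPoly (hμ : μ.IsNontrivial) (hμ1 : μ.IsProbability) (k : Fin d)
    (σ : Word d) :
    (defect (μ.verblunsky (Word.letter k * σ)) : ℂ) • μ.orthoPoly hμ (Word.letter k * σ) =
      Z k * μ.orthoPoly hμ σ - μ.verblunsky (Word.letter k * σ) •
        μ.reverseOrthoPoly hμ (Word.letter k * σ).pred := by
  let _ := normedGroup hμ
  let _ := innerSpace hμ
  have h := defect_smul_fwd_succ (e := natMonomial d)
    (linearIndependent_natMonomial k.pos hμ) (norm_natMonomial hμ hμ1)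
    (Word.letter k * σ).pred.rank 0
  rwa [← Word.rank_letter_mul, fwd_rank_zero k.pos hμ hμ1, zero_add, fwd_rank_one k.pos hμ hμ1,
    bwd_rank_zero k.pos hμ hμ1, ← verblunsky_letter_mul k.pos hμ hμ1] at h

theorem defect_verblunsky_ne_zero (hμ : μ.IsNontrivial) (hμ1 : μ.IsProbability) (σ : Word d) :
    (defect (μ.verblunsky σ) : ℂ) ≠ 0 := by
  exact_mod_cast (defect_pos (norm_verblunsky_lt_one hμ hμ1 σ)).ne'

theorem defect_smul_reverseOrthoPoly (hμ : μ.IsNontrivial) (hμ1 : μ.IsProbability) (k : Fin d)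
    (σ : Word d) :
    (defect (μ.verblunsky (Word.letter k * σ)) : ℂ) • μ.reverseOrthoPoly hμ (Word.letter k * σ) =
      -((starRingEnd ℂ) (μ.verblunsky (Word.letter k * σ)) • (Z k * μ.orthoPoly hμ σ)) +
        μ.reverseOrthoPoly hμ (Word.letter k * σ).pred := by
  rw [reverseOrthoPoly_letter_mul, smul_inv_smul₀ (defect_verblunsky_ne_zero hμ hμ1 _)]

theorem a_self_ne_zero (hμ : μ.IsNontrivial) (σ : Word d) : μ.a hμ σ σ ≠ 0 := by
  let _ := normedGroup hμ
  let _ := innerSpace hμ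
  obtain ⟨c, hc, h⟩ := (isResidual_orthoPoly hμ σ).lead
  have h1 := coeff_eq_zero_of_mem_span h (σ := σ) (lt_irrefl σ)
  rw [sub_eq_add_neg, MonoidAlgebra.coeff_add, ← neg_smul, MonoidAlgebra.coeff_smul,
    Finsupp.add_apply, Finsupp.smul_apply, coeff_monomial, if_pos rfl, smul_eq_mul, mul_one] at h1
  rw [a, eq_neg_of_add_eq_zero_left h1, neg_neg]
  exact_mod_cast hc.ne'

theorem orthoPoly_eq_smul_monicPoly (hμ : μ.IsNontrivial) (σ : Word d) :
    μ.orthoPoly hμ σ = μ.a hμ σ σ • μ.monicPoly hμ σ := by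
  let _ := normedGroup hμ
  let _ := innerSpace hμ
  have h1 : (μ.monicPoly hμ σ).coeff σ = 1 := by
    have h := coeff_eq_zero_of_mem_span
      (gramSchmidt_sub_mem_span (monomial : Word d → NCPoly d) σ) (σ := σ) (lt_irrefl σ)
    rw [sub_eq_add_neg, ← neg_one_smul ℂ (monomial σ), MonoidAlgebra.coeff_add,
      MonoidAlgebra.coeff_smul, Finsupp.add_apply, Finsupp.smul_apply, coeff_monomial,
      if_pos rfl, smul_eq_mul, mul_one] at h
    exact (eq_neg_of_add_eq_zero_left h).trans (neg_neg 1)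
  have h2 : μ.orthoPoly hμ σ = (‖μ.monicPoly hμ σ‖ : ℂ)⁻¹ • μ.monicPoly hμ σ := rfl
  rw [a, h2, MonoidAlgebra.coeff_smul, Finsupp.smul_apply, h1, smul_eq_mul, mul_one]

theorem reverseOrthoPoly_eq_smul_reverseMonicPoly (hμ : μ.IsNontrivial) (σ : Word d) :
    μ.reverseOrthoPoly hμ σ = μ.a hμ σ σ • μ.reverseMonicPoly hμ σ := by
  rw [reverseMonicPoly, smul_inv_smul₀ (a_self_ne_zero hμ σ)]

theorem coeff_reverseOrthoPoly_eq_zero (hd : 0 < d) (hμ : μ.IsNontrivial) (hμ1 : μ.IsProbability)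
    {σ τ : Word d} (h : σ < τ) : (μ.reverseOrthoPoly hμ σ).coeff τ = 0 := by
  let _ := normedGroup hμ
  let _ := innerSpace hμ
  have h1 := (isResidual_bwd_fwd (e := natMonomial d)
    (linearIndependent_natMonomial hd hμ) (norm_natMonomial hμ hμ1)
    σ.rank 0).1.mem_span (t := Set.Iic σ.rank) (by simp)
    (fun m hm => by simpa using hm.2)
  rw [bwd_rank_zero hd hμ hμ1] at h1
  rw [natMonomial, Set.image_comp] at h1
  refine coeff_eq_zero_of_mem_span h1 ?_
  rw [← Word.coe_nthIso hd, OrderIso.image_Iic, Word.coe_nthIso, Word.nth_rank]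
  exact fun h2 => (Set.mem_Iic.1 h2).not_gt h

/-- The leading coefficients in the Szegő recurrence. -/
theorem defect_mul_a (hμ : μ.IsNontrivial) (hμ1 : μ.IsProbability) (k : Fin d) (σ : Word d) :
    (defect (μ.verblunsky (Word.letter k * σ)) : ℂ) *
      μ.a hμ (Word.letter k * σ) (Word.letter k * σ) = μ.a hμ σ σ := by
  have h := congrArg (fun P : NCPoly d => P.coeff (Word.letter k * σ))
    (defect_smul_orthoPoly hμ hμ1 k σ)
  rw [sub_eq_add_neg, ← neg_smul, MonoidAlgebra.coeff_add, MonoidAlgebra.coeff_smul,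
    MonoidAlgebra.coeff_smul, Finsupp.add_apply, Finsupp.smul_apply, Finsupp.smul_apply,
    coeff_Z_mul, coeff_reverseOrthoPoly_eq_zero k.pos hμ hμ1 (Word.pred_letter_mul_lt k σ),
    smul_zero, add_zero] at h
  exact h

end NCMeasure

end NCSzego

end

theorem mainTheorem7 (d : ℕ) (μ : NCSzego.NCMeasure d) (hμ : μ.IsNontrivial)
    (hμ1 : μ.IsProbability) :
    (∀ σ : NCSzego.Word d, μ.a hμ σ σ ≠ 0 ∧ ‖μ.verblunsky σ‖ < 1) ∧
    ∀ (k : Fin d) (σ : NCSzego.Word d),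
      μ.monicPoly hμ (NCSzego.Word.letter k * σ) =
          NCSzego.Z k * μ.monicPoly hμ σ -
            (μ.verblunsky (NCSzego.Word.letter k * σ) *
              (μ.a hμ (NCSzego.Word.letter k * σ).pred (NCSzego.Word.letter k * σ).pred /
                μ.a hμ σ σ)) •
              μ.reverseMonicPoly hμ (NCSzego.Word.letter k * σ).pred ∧
      μ.reverseMonicPoly hμ (NCSzego.Word.letter k * σ) =
          -((starRingEnd ℂ) (μ.verblunsky (NCSzego.Word.letter k * σ)) •
              (NCSzego.Z k * μ.monicPoly hμ σ)) +
            (μ.a hμ (NCSzego.Word.letter k * σ).pred (NCSzego.Word.letter k * σ).pred /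
              μ.a hμ σ σ) •
              μ.reverseMonicPoly hμ (NCSzego.Word.letter k * σ).pred := by
  refine ⟨fun σ => ⟨NCSzego.NCMeasure.a_self_ne_zero hμ σ,
    NCSzego.NCMeasure.norm_verblunsky_lt_one hμ hμ1 σ⟩, fun k σ => ?_⟩
  have ha := NCSzego.NCMeasure.a_self_ne_zero hμ
  have hd := NCSzego.NCMeasure.defect_verblunsky_ne_zero hμ hμ1 (NCSzego.Word.letter k * σ)
  have hda := NCSzego.NCMeasure.defect_mul_a hμ hμ1 k σ
  have h1 := NCSzego.NCMeasure.defect_smul_orthoPoly hμ hμ1 k σ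
  have h2 := NCSzego.NCMeasure.defect_smul_reverseOrthoPoly hμ hμ1 k σ
  simp only [NCSzego.NCMeasure.orthoPoly_eq_smul_monicPoly hμ,
    NCSzego.NCMeasure.reverseOrthoPoly_eq_smul_reverseMonicPoly hμ, smul_smul, mul_smul_comm, hda]
    at h1 h2
  -- both recurrences now hold with the common factor `a_{σ,σ}`
  constructor
  · refine smul_right_injective _ (ha σ) ?_
    change μ.a hμ σ σ • _ = μ.a hμ σ σ • _
    rw [h1, smul_sub, smul_smul, mul_left_comm, mul_div_cancel₀ _ (ha σ)]
  · refine smul_right_injective _ (ha σ) ?_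
    change μ.a hμ σ σ • _ = μ.a hμ σ σ • _
    rw [h2, smul_add, smul_neg, smul_smul, smul_smul, mul_div_cancel₀ _ (ha σ), mul_comm]
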